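/- Work in continuous first-order logic for (possibly many-sorted) bounded complete metric structures: formulas are real-valued and are built from distances and predicates by continuous connectives and the quantifiers $\sup$ and $\inf$. Let $T$ be a complete continuous theory with monster model $\mathcal U$ (a model that is $\kappa$-saturated and strongly $\kappa$-homogeneous for some uncountable $\kappa$ larger than the signature). Formulas $\varphi(x,y)$ below have finite tuples of variables $x,y$. * $T$ is *NIP* if there are no formula $\varphi(x,y)$, model $M\models T$, reals $r<s$ and tuples $(a_i)_{i<\omega}$, $(b_I)_{I\subseteq\omega}$ in $M$ such that $\varphi(b_I,a_i)\le r$ for $i\in I$ and $\varphi(b_I,a_i)\ge s$ for $i\notin I$. * $T$ is *SCP* if there are no formula $\varphi(x,y)$, indiscernible sequence $(a_i)_{i<\omega}$ in $\mathcal U$, sequence $(b_i)_{i<\omega}$ in $\mathcal U$ and $\varepsilon>0$ such that the sequence $(\varphi(b,a_i))_{i<\omega}$ converges for every $b\in\mathcal U$, and $\varphi(b_j,a_i)+\varepsilon<\varphi(b_i,a_j)$ for all $i<j<\omega$. * $T$ is *stable* if there are no formula $\varphi(x,y)$, model $M\models T$, $\varepsilon>0$ and sequences $(a_i)_{i<\omega}$,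 $(b_i)_{i<\omega}$ in $M$ such that $|\varphi(a_i,b_j)-\varphi(a_j,b_i)|\ge\varepsilon$ for all $i<j<\omega$. Suppose that $T$ is NIP and SCP. Then $T$ is stable. -/

import Mathlib

open Filter Topology Cardinal

/-! Continuous first-order logic for (many-sorted, bounded, complete) metric structures. -/

universe u v v' w

namespace ContLogic

/-- A signature of continuous logic: sorts with a bound on their diameters, function symbols and
predicate symbols with their sorts, a bounded closed interval for every predicate symbol, and a
modulus of uniform continuity for every symbol. A one-sorted signature is the case of a one-point
type of sorts. -/
structure Language where
  Sorts : Type u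
  /-- bound on the diameter of each sort -/
  diam : Sorts → ℝ
  Fn : Type u
  fnDom : Fn → List Sorts
  fnCod : Fn → Sorts
  fnMod : Fn → ℝ → ℝ
  fnMod_pos : ∀ f ε, 0 < ε → 0 < fnMod f ε
  Pred : Type u
  predDom : Pred → List Sorts
  /-- lower and upper end of the interval in which a predicate takes its values -/
  predLo : Pred → ℝ
  predHi : Pred → ℝ
  predMod : Pred → ℝ → ℝ
  predMod_pos : ∀ P ε, 0 < ε → 0 < predMod P ε

/-- The number of sorts and non-logical symbols. -/
def Language.card (L : Language.{u}) : Cardinal.{u} := #L.Sorts + #L.Fn + #L.Pred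

/-- A metric structure: every sort is a nonempty complete metric space of bounded diameter, and the
symbols are interpreted by uniformly continuous maps that respect the moduli of the signature. -/
structure MetricStructure (L : Language.{u}) where
  carrier : L.Sorts → Type w
  metric : ∀ s, MetricSpace (carrier s)
  complete : ∀ s, CompleteSpace (carrier s)
  nonempty : ∀ s, Nonempty (carrier s)
  dist_le : ∀ s (x y : carrier s), dist x y ≤ L.diam s
  fn : ∀ f : L.Fn, (∀ i : Fin (L.fnDom f).length, carrier ((L.fnDom f).get i)) →
    carrier (L.fnCod f)
  fn_unif : ∀ (f : L.Fn) (ε : ℝ), 0 < ε → ∀ x y, (∀ i, dist (x i) (y i) < L.fnMod f ε) →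
    dist (fn f x) (fn f y) ≤ ε
  pred : ∀ P : L.Pred, (∀ i : Fin (L.predDom P).length, carrier ((L.predDom P).get i)) → ℝ
  pred_mem : ∀ P x, pred P x ∈ Set.Icc (L.predLo P) (L.predHi P)
  pred_unif : ∀ (P : L.Pred) (ε : ℝ), 0 < ε → ∀ x y, (∀ i, dist (x i) (y i) < L.predMod P ε) →
    |pred P x - pred P y| ≤ ε

attribute [instance] MetricStructure.metric MetricStructure.complete MetricStructure.nonempty

variable {L : Language.{u}}

/-- A context of variables: `X s` is the type of variables of sort `s`. -/
abbrev Ctx (L : Language.{u}) := L.Sorts → Type v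

/-- There are finitely many variables in the context, i.e. it is a finite tuple of variables. -/
def Ctx.IsFinite (X : Ctx.{u, v} L) : Prop := Finite (Σ s, X s)

/-- The context `X` together with one new variable of sort `s`. -/
abbrev Ctx.snoc (X : Ctx.{u, v} L) (s : L.Sorts) : Ctx.{u, v} L :=
  fun t => X t ⊕ PLift (s = t)

/-- The context of two tuples of variables put side by side. -/
abbrev Ctx.sum (X : Ctx.{u, v} L) (Y : Ctx.{u, v'} L) : Ctx.{u, max v v'} L :=
  fun s => X s ⊕ Y s

/-- The context of `k` disjoint copies of a tuple of variables. -/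
abbrev Ctx.copies (k : ℕ) (Y : Ctx.{u, v} L) : Ctx.{u, v} L := fun s => Fin k × Y s

/-- The context without variables. -/
abbrev Ctx.empty (L : Language.{u}) : Ctx.{u, 0} L := fun _ => Empty

/-- Terms of sort `s` with variables from `X`. -/
inductive Term (X : Ctx.{u, v} L) : L.Sorts → Type (max u v)
  | var {s : L.Sorts} (x : X s) : Term X s
  | app (f : L.Fn) (ts : ∀ i : Fin (L.fnDom f).length, Term X ((L.fnDom f).get i)) :
      Term X (L.fnCod f)

/-- Formulas with free variables from `X`: built from distances between terms and predicates by
arbitrary continuous connectives of finite arity and the quantifiers `sup` and `inf`. -/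
inductive Formula : Ctx.{u, v} L → Type (max u (v + 1))
  | dist {X : Ctx.{u, v} L} {s : L.Sorts} (t₁ t₂ : Term X s) : Formula X
  | pred {X : Ctx.{u, v} L} (P : L.Pred)
      (ts : ∀ i : Fin (L.predDom P).length, Term X ((L.predDom P).get i)) : Formula X
  | conn {X : Ctx.{u, v} L} {n : ℕ} (c : C(Fin n → ℝ, ℝ)) (φs : Fin n → Formula X) : Formula X
  | sup {X : Ctx.{u, v} L} (s : L.Sorts) (φ : Formula (X.snoc s)) : Formula X
  | inf {X : Ctx.{u, v} L} (s : L.Sorts) (φ : Formula (X.snoc s)) : Formula X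

/-- Sentences are formulas without free variables. -/
abbrev Sentence (L : Language.{u}) := Formula (Ctx.empty L)

/-- A tuple in `M` indexed by the variables of `X` (an assignment of these variables). -/
abbrev MetricStructure.Tuple (M : MetricStructure.{u, w} L) (X : Ctx.{u, v} L) :=
  ∀ s, X s → M.carrier s

/-- Extend an assignment by the value `a` of the new variable. -/
def MetricStructure.Tuple.snoc {M : MetricStructure.{u, w} L} {X : Ctx.{u, v} L}
    (x : M.Tuple X) {s : L.Sorts} (a : M.carrier s) : M.Tuple (X.snoc s) :=
  fun _ z => match z with
    | Sum.inl y => x _ y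
    | Sum.inr h => h.down ▸ a

/-- The concatenation of two tuples. -/
def MetricStructure.Tuple.append {M : MetricStructure.{u, w} L} {X : Ctx.{u, v} L}
    {Y : Ctx.{u, v'} L} (x : M.Tuple X) (y : M.Tuple Y) : M.Tuple (X.sum Y) :=
  fun s => Sum.elim (x s) (y s)

/-- The concatenation of `k` tuples. -/
def MetricStructure.Tuple.join {M : MetricStructure.{u, w} L} {Y : Ctx.{u, v} L} {k : ℕ}
    (a : Fin k → M.Tuple Y) : M.Tuple (Y.copies k) :=
  fun s z => a z.1 s z.2

/-- The value of a term. -/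
def Term.eval (M : MetricStructure.{u, w} L) {X : Ctx.{u, v} L} (x : M.Tuple X) :
    {s : L.Sorts} → Term X s → M.carrier s
  | _, .var y => x _ y
  | _, .app f ts => M.fn f (fun i => (ts i).eval M x)

/-- The (real) value of a formula. -/
noncomputable def Formula.eval (M : MetricStructure.{u, w} L) :
    {X : Ctx.{u, v} L} → Formula X → M.Tuple X → ℝ
  | _, .dist t₁ t₂, x => Dist.dist (t₁.eval M x) (t₂.eval M x)
  | _, .pred P ts, x => M.pred P (fun i => (ts i).eval M x)
  | _, .conn c φs, x => c (fun i => (φs i).eval M x)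
  | _, .sup s φ, x => ⨆ a : M.carrier s, φ.eval M (x.snoc a)
  | _, .inf s φ, x => ⨅ a : M.carrier s, φ.eval M (x.snoc a)

/-- The values of a formula are bounded, uniformly over all structures, so that the suprema and
infima in `Formula.eval` are those of nonempty bounded sets. -/
theorem Formula.exists_bound {X : Ctx.{u, v} L} (φ : Formula X) :
    ∃ C : ℝ, ∀ (M : MetricStructure.{u, w} L) (x : M.Tuple X), |φ.eval M x| ≤ C := by
  induction φ with
  | @dist X s t₁ t₂ =>
    refine ⟨L.diam s, fun M x => ?_⟩
    rw [Formula.eval, abs_of_nonneg dist_nonneg]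
    exact M.dist_le s _ _
  | pred P ts =>
    refine ⟨max |L.predLo P| |L.predHi P|, fun M x => ?_⟩
    rw [Formula.eval]
    have h := M.pred_mem P (fun i => (ts i).eval M x)
    exact abs_le_max_abs_abs h.1 h.2
  | @conn X n c φs ih =>
    choose C hC using ih
    obtain ⟨B, hB⟩ := (isCompact_univ_pi (fun i : Fin n =>
      isCompact_Icc (a := -C i) (b := C i))).exists_bound_of_continuousOn c.continuous.continuousOn
    refine ⟨B, fun M x => ?_⟩
    rw [Formula.eval]
    exact hB _ (fun i _ => abs_le.mp (hC i M x))
  | sup s φ ih =>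
    obtain ⟨C, hC⟩ := ih
    refine ⟨C, fun M x => ?_⟩
    rw [Formula.eval]
    have hb : BddAbove (Set.range fun a : M.carrier s => φ.eval M (x.snoc a)) :=
      ⟨C, by rintro _ ⟨a, rfl⟩; exact (abs_le.mp (hC M _)).2⟩
    obtain ⟨a⟩ := M.nonempty s
    exact abs_le.mpr ⟨(abs_le.mp (hC M _)).1.trans (le_ciSup hb a),
      ciSup_le fun a => (abs_le.mp (hC M _)).2⟩
  | inf s φ ih =>
    obtain ⟨C, hC⟩ := ih
    refine ⟨C, fun M x => ?_⟩
    rw [Formula.eval]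
    have hb : BddBelow (Set.range fun a : M.carrier s => φ.eval M (x.snoc a)) :=
      ⟨-C, by rintro _ ⟨a, rfl⟩; exact (abs_le.mp (hC M _)).1⟩
    obtain ⟨a⟩ := M.nonempty s
    exact abs_le.mpr ⟨le_ciInf fun a => (abs_le.mp (hC M _)).1,
      (ciInf_le hb a).trans (abs_le.mp (hC M _)).2⟩

/-- The value `φ(x, y)` of a formula in two tuples of variables. -/
noncomputable def Formula.eval₂ (M : MetricStructure.{u, w} L) {X : Ctx.{u, v} L}
    {Y : Ctx.{u, v'} L} (φ : Formula (X.sum Y)) (x : M.Tuple X) (y : M.Tuple Y) : ℝ :=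
  φ.eval M (x.append y)

/-- The value of a sentence. -/
noncomputable def MetricStructure.value (M : MetricStructure.{u, w} L) (φ : Sentence L) : ℝ :=
  φ.eval M (fun _ z => z.elim)

/-- A theory is a set of closed conditions `φ = 0`, given by the sentences `φ`. -/
abbrev Theory (L : Language.{u}) := Set (Sentence L)

/-- `M` is a model of `T`. -/
def MetricStructure.IsModel (M : MetricStructure.{u, w} L) (T : Theory L) : Prop :=
  ∀ φ ∈ T, M.value φ = 0

/-- A theory is complete if it has a model and every sentence has the same value in all models. -/
def Theory.IsComplete (T : Theory L) : Prop :=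
  (∃ M : MetricStructure.{u, w} L, M.IsModel T) ∧
    ∀ M N : MetricStructure.{u, w} L, M.IsModel T → N.IsModel T → ∀ φ, M.value φ = N.value φ

/-! ### Monster models -/

/-- A set of elements (of any sorts) of `M`, viewed as a context of names for its elements. -/
abbrev MetricStructure.Params (M : MetricStructure.{u, w} L) (A : ∀ s, Set (M.carrier s)) :
    Ctx.{u, w} L :=
  fun s => A s

/-- The tuple that interprets every name by the element it names. -/
def MetricStructure.paramTuple (M : MetricStructure.{u, w} L) (A : ∀ s, Set (M.carrier s)) :
    M.Tuple (M.Params A) :=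
  fun _ a => a.1

/-- `κ`-saturation: every set of conditions `φ(x, A) = 0` in a finite tuple `x` of variables, with
fewer than `κ` parameters, that is approximately finitely satisfied in `M` is satisfied in `M`. -/
def MetricStructure.IsSaturated (M : MetricStructure.{u, w} L) (κ : Cardinal.{max u w}) : Prop :=
  ∀ A : ∀ s, Set (M.carrier s), #(Σ s, A s) < κ →
    ∀ X : Ctx.{u, 0} L, X.IsFinite → ∀ p : Set (Formula (X.sum (M.Params A))),
      (∀ p₀ ⊆ p, p₀.Finite → ∀ δ > 0, ∃ x : M.Tuple X,
        ∀ φ ∈ p₀, |φ.eval₂ M x (M.paramTuple A)| ≤ δ) →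
      ∃ x : M.Tuple X, ∀ φ ∈ p, φ.eval₂ M x (M.paramTuple A) = 0

/-- Automorphisms of a metric structure. -/
structure MetricStructure.Aut (M : MetricStructure.{u, w} L) where
  toIso : ∀ s, M.carrier s ≃ᵢ M.carrier s
  map_fn : ∀ f x, toIso _ (M.fn f x) = M.fn f (fun i => toIso _ (x i))
  map_pred : ∀ P x, M.pred P (fun i => toIso _ (x i)) = M.pred P x

/-- Strong `κ`-homogeneity: every elementary map from a set of fewer than `κ` elements of `M` to `M`
extends to an automorphism of `M`. -/
def MetricStructure.IsStronglyHomogeneous (M : MetricStructure.{u, w} L)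
    (κ : Cardinal.{max u w}) : Prop :=
  ∀ A : ∀ s, Set (M.carrier s), #(Σ s, A s) < κ → ∀ f : M.Tuple (M.Params A),
    (∀ φ : Formula (M.Params A), φ.eval M f = φ.eval M (M.paramTuple A)) →
      ∃ g : M.Aut, ∀ s (a : A s), g.toIso s a.1 = f s a

/-- `U` is a monster model of `T`: a model that is `κ`-saturated and strongly `κ`-homogeneous for
some uncountable `κ` larger than the signature. -/
def MetricStructure.IsMonster (U : MetricStructure.{u, w} L) (T : Theory L) : Prop :=
  U.IsModel T ∧ ∃ κ : Cardinal.{max u w}, ℵ₀ < κ ∧ Cardinal.lift.{w} L.card < κ ∧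
    U.IsSaturated κ ∧ U.IsStronglyHomogeneous κ

/-! ### Properties of formulas and theories -/

/-- The formula `φ(x, y)` has the independence property in `M`. -/
def Formula.HasIP (M : MetricStructure.{u, w} L) {X Y : Ctx.{u, 0} L}
    (φ : Formula (X.sum Y)) : Prop :=
  ∃ (r s : ℝ) (a : ℕ → M.Tuple Y), r < s ∧ ∀ I : Set ℕ, ∃ b : M.Tuple X, ∀ i,
    (i ∈ I → φ.eval₂ M b (a i) ≤ r) ∧ (i ∉ I → s ≤ φ.eval₂ M b (a i))

/-- The formula `φ(x, y)` has the order property in `M`. -/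
def Formula.HasOP (M : MetricStructure.{u, w} L) {X Y : Ctx.{u, 0} L}
    (φ : Formula (X.sum Y)) : Prop :=
  ∃ (ε : ℝ) (a : ℕ → M.Tuple X) (b : ℕ → M.Tuple Y), 0 < ε ∧
    ∀ i j, i < j → ε ≤ |φ.eval₂ M (a i) (b j) - φ.eval₂ M (a j) (b i)|

/-- The theory `T` is NIP: no formula `φ(x, y)`, with finite tuples `x` and `y` of variables, has
the independence property in a model of `T`. -/
def Theory.IsNIP (T : Theory L) : Prop :=
  ∀ M : MetricStructure.{u, w} L, M.IsModel T → ∀ X Y : Ctx.{u, 0} L, X.IsFinite → Y.IsFinite →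
    ∀ φ : Formula (X.sum Y), ¬ φ.HasIP M

/-- The theory `T` is stable: no formula `φ(x, y)`, with finite tuples `x` and `y` of variables,
has the order property in a model of `T`. -/
def Theory.IsStable (T : Theory L) : Prop :=
  ∀ M : MetricStructure.{u, w} L, M.IsModel T → ∀ X Y : Ctx.{u, 0} L, X.IsFinite → Y.IsFinite →
    ∀ φ : Formula (X.sum Y), ¬ φ.HasOP M

/-- A sequence of tuples is indiscernible (over the empty set): all its increasing finite
subsequences of the same length satisfy the same conditions. -/
def MetricStructure.IsIndiscernible (M : MetricStructure.{u, w} L) {Y : Ctx.{u, 0} L}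
    (a : ℕ → M.Tuple Y) : Prop :=
  ∀ (k : ℕ) (ψ : Formula (Y.copies k)) (i j : Fin k → ℕ), StrictMono i → StrictMono j →
    ψ.eval M (.join fun l => a (i l)) = ψ.eval M (.join fun l => a (j l))

/-- The formula `φ(x, y)` has NSCP in the monster model `U`: for some indiscernible sequence
`(a i)`, some sequence `(b i)` and some `ε > 0`, the sequence `φ(c, a i)` converges for every `c`
in `U`, and `φ(b j, a i) + ε < φ(b i, a j)` whenever `i < j`. -/
def Formula.HasNSCP (U : MetricStructure.{u, w} L) {X Y : Ctx.{u, 0} L}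
    (φ : Formula (X.sum Y)) : Prop :=
  ∃ (a : ℕ → U.Tuple Y) (b : ℕ → U.Tuple X) (ε : ℝ), 0 < ε ∧ U.IsIndiscernible a ∧
    (∀ c : U.Tuple X, ∃ l : ℝ, Tendsto (fun i => φ.eval₂ U c (a i)) atTop (𝓝 l)) ∧
    ∀ i j, i < j → φ.eval₂ U (b j) (a i) + ε < φ.eval₂ U (b i) (a j)

/-- The theory with monster model `U` is SCP: no formula `φ(x, y)`, with finite tuples `x` and `y`
of variables, has NSCP in `U`. -/
def MetricStructure.IsSCP (U : MetricStructure.{u, w} L) : Prop :=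
  ∀ X Y : Ctx.{u, 0} L, X.IsFinite → Y.IsFinite → ∀ φ : Formula (X.sum Y), ¬ φ.HasNSCP U

end ContLogic

/-! Under NIP the convergence clause in NSCP is automatic along indiscernible sequences, so SCP
leaves no room for the order property.

Suppose `φ` has the order property in `M`, witnessed by pairs `(p i, q i)`. Iterated limits along a
nonprincipal ultrafilter on `ℕ` give a coherent family of types in any number of copies of the
variables. The type for `k` copies is the marginal on every increasing choice of `k` among `n`
copies, so a sequence realizing the family is automatically indiscernible and no Ramsey argument is
needed. Saturation and completeness of `T` realize it in `U` (`IsSaturated.exists_indiscernible`).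
The difference `φ(x, y') - φ(x', y)` is then constant on increasing pairs and at least `ε` in
absolute value; according to its sign, `φ` or `-φ` satisfies the order clause of NSCP
(`HasOP.exists_indiscernible`).

If `φ(c, a i)` failed to converge, it would cross some gap `r < s` infinitely often. Every pattern
`I ⊆ ℕ` would then be cut out by `c` on a subsequence, hence, by indiscernibility and saturation, by
some `b` on the sequence itself, which is IP (`exists_tendsto_of_not_hasIP`). So NSCP holds for `φ`
or `-φ`, contradicting SCP. -/

namespace ContLogic

variable {L : Language.{u}}

/-! ### Renaming variables -/

/-- Rename the variables of a term. -/
def Term.rename {X : Ctx.{u, v} L} {X' : Ctx.{u, v'} L} (f : ∀ s, X s → X' s) :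
    {s : L.Sorts} → Term X s → Term X' s
  | _, .var x => .var (f _ x)
  | _, .app g ts => .app g fun i => (ts i).rename f

/-- Rename the free variables of a formula. -/
def Formula.rename : {X : Ctx.{u, v} L} → Formula X → {X' : Ctx.{u, v'} L} →
    (∀ s, X s → X' s) → Formula X'
  | _, .dist t₁ t₂, _, f => .dist (t₁.rename f) (t₂.rename f)
  | _, .pred P ts, _, f => .pred P fun i => (ts i).rename f
  | _, .conn c φs, _, f => .conn c fun i => (φs i).rename f
  | _, .sup s φ, _, f => .sup s (φ.rename fun t => Sum.map (f t) id)
  | _, .inf s φ, _, f => .inf s (φ.rename fun t => Sum.map (f t) id)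

theorem Term.eval_rename (M : MetricStructure.{u, w} L) {X : Ctx.{u, v} L} {X' : Ctx.{u, v'} L}
    (f : ∀ s, X s → X' s) (x : M.Tuple X') {s : L.Sorts} (t : Term X s) :
    (t.rename f).eval M x = t.eval M fun s z => x s (f s z) := by
  induction t with
  | var y => rfl
  | app g ts ih =>
    rw [Term.rename, Term.eval, Term.eval]
    exact congrArg _ (funext ih)

theorem MetricStructure.Tuple.snoc_rename {M : MetricStructure.{u, w} L} {X : Ctx.{u, v} L}
    {X' : Ctx.{u, v'} L} (f : ∀ s, X s → X' s) (x : M.Tuple X') {s : L.Sorts}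
    (a : M.carrier s) :
    (fun t z => x.snoc a t (Sum.map (f t) id z)) =
      Tuple.snoc (M := M) (X := X) (fun t z => x t (f t z)) a := by
  funext t z
  rcases z with z | z <;> rfl

theorem Formula.eval_rename (M : MetricStructure.{u, w} L) {X : Ctx.{u, v} L} (φ : Formula X)
    {X' : Ctx.{u, v'} L} (f : ∀ s, X s → X' s) (x : M.Tuple X') :
    (φ.rename f).eval M x = φ.eval M fun s z => x s (f s z) := by
  induction φ generalizing X' with
  | dist t₁ t₂ => simp only [Formula.rename, Formula.eval, Term.eval_rename]
  | pred P ts => simp only [Formula.rename, Formula.eval, Term.eval_rename]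
  | conn c φs ih => simp only [Formula.rename, Formula.eval, ih]
  | sup s φ ih => simp only [Formula.rename, Formula.eval, ih, MetricStructure.Tuple.snoc_rename]
  | inf s φ ih => simp only [Formula.rename, Formula.eval, ih, MetricStructure.Tuple.snoc_rename]

/-! ### Connectives and quantifiers over finite tuples -/

/-- Apply a unary connective. -/
def Formula.map {X : Ctx.{u, v} L} (c : C(ℝ, ℝ)) (φ : Formula X) : Formula X :=
  .conn (n := 1) ⟨fun v => c (v 0), by fun_prop⟩ fun _ => φ

theorem Formula.eval_map (M : MetricStructure.{u, w} L) {X : Ctx.{u, v} L} (c : C(ℝ, ℝ))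
    (φ : Formula X) (x : M.Tuple X) : (φ.map c).eval M x = c (φ.eval M x) := rfl

/-- Merges finitely many conditions `φ i = 0` into one formula: a bound on the sum bounds each term.
-/
theorem Formula.exists_sum_abs {X : Ctx.{u, v} L} {ι : Type*} (F : Finset ι)
    (φ : ι → Formula X) : ∃ θ : Formula X, ∀ (M : MetricStructure.{u, w} L) (x : M.Tuple X),
      θ.eval M x = ∑ i ∈ F, |(φ i).eval M x| := by
  refine ⟨.conn (n := F.card) ⟨fun v => ∑ i, |v i|, by fun_prop⟩
    fun i => φ (F.equivFin.symm i), fun M x => ?_⟩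
  rw [Formula.eval, ← Finset.sum_coe_sort F fun i => |(φ i).eval M x|]
  exact Equiv.sum_comp F.equivFin.symm fun i : F => |(φ i).eval M x|

theorem Formula.eval_inf_lt_iff (M : MetricStructure.{u, w} L) {X : Ctx.{u, v} L} {s : L.Sorts}
    (φ : Formula (X.snoc s)) (x : M.Tuple X) (δ : ℝ) :
    (Formula.inf s φ).eval M x < δ ↔ ∃ a, φ.eval M (x.snoc a) < δ := by
  obtain ⟨C, hC⟩ := Formula.exists_bound.{u, v, w} φ
  rw [Formula.eval]
  exact ciInf_lt_iff ⟨-C, by rintro _ ⟨a, rfl⟩; exact (abs_le.mp (hC M _)).1⟩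

/-- Induction on the number of variables, quantifying one at a time. The strict inequality matters:
the infimum need not be attained. -/
theorem Formula.exists_inf_tuple {X : Ctx.{u, 0} L} (hX : X.IsFinite) {Y : Ctx.{u, v} L}
    (φ : Formula (X.sum Y)) : ∃ θ : Formula Y, ∀ (M : MetricStructure.{u, w} L) (y : M.Tuple Y)
      (δ : ℝ), θ.eval M y < δ ↔ ∃ x : M.Tuple X, φ.eval₂ M x y < δ := by
  classical
  induction hn : Nat.card (Σ s, X s) generalizing X with
  | zero =>
    have he : IsEmpty (Σ s, X s) :=
      (Nat.card_eq_zero.mp hn).resolve_right (not_infinite_iff_finite.mpr hX)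
    let f : ∀ s, X.sum Y s → Y s := fun s => Sum.elim (fun z => (he.false ⟨s, z⟩).elim) id
    refine ⟨φ.rename f, fun M y δ => ?_⟩
    have key : ∀ x : M.Tuple X, (fun s z => y s (f s z)) = x.append y := by
      intro x
      funext s z
      rcases z with z | z
      · exact (he.false ⟨s, z⟩).elim
      · rfl
    rw [Formula.eval_rename]
    constructor
    · intro h
      refine ⟨fun s z => (he.false ⟨s, z⟩).elim, ?_⟩
      rwa [Formula.eval₂, ← key]
    · rintro ⟨x, h⟩
      rwa [key x]
  | succ n ih =>
    have : Finite (Σ s, X s) := hX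
    have hne : Nonempty (Σ s, X s) := by
      by_contra h
      rw [not_nonempty_iff] at h
      simp at hn
    obtain ⟨z₀⟩ := hne
    let X' : Ctx.{u, 0} L := fun s => {z : X s // (⟨s, z⟩ : Σ s, X s) ≠ z₀}
    let e : (Σ s, X' s) ≃ {p : Σ s, X s // p ≠ z₀} :=
      { toFun := fun p => ⟨⟨p.1, p.2.1⟩, p.2.2⟩
        invFun := fun p => ⟨p.1.1, ⟨p.1.2, p.2⟩⟩
        left_inv := fun _ => rfl
        right_inv := fun _ => rfl }
    have hX' : X'.IsFinite := Finite.of_equiv _ e.symm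
    have hcard : Nat.card (Σ s, X' s) = n := by
      rw [Nat.card_congr e]
      have h1 := Set.ncard_sdiff_singleton_add_one (Set.mem_univ z₀)
      rw [Set.ncard_univ, hn] at h1
      have h2 : Nat.card {p : Σ s, X s // p ≠ z₀} = (Set.univ \ {z₀}).ncard := by
        rw [← Nat.card_coe_set_eq]
        exact Nat.card_congr (Equiv.subtypeEquivRight fun p => by simp)
      omega
    -- The chosen variable `z₀` becomes the new bound variable; all others stay free.
    let f : ∀ s, X.sum Y s → (X'.sum Y).snoc z₀.1 s := fun s => Sum.elim
      (fun z => if h : (⟨s, z⟩ : Σ s, X s) = z₀ then Sum.inr ⟨(congrArg Sigma.fst h).symm⟩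
        else Sum.inl (Sum.inl ⟨z, h⟩))
      fun z => Sum.inl (Sum.inr z)
    obtain ⟨θ, hθ⟩ := ih hX' (.inf z₀.1 (φ.rename f)) hcard
    refine ⟨θ, fun M y δ => ?_⟩
    simp only [hθ, Formula.eval₂, Formula.eval_inf_lt_iff, Formula.eval_rename]
    constructor
    · rintro ⟨x', a, h⟩
      refine ⟨fun s z => (x'.append y).snoc a s (f s (Sum.inl z)), ?_⟩
      convert h using 2
      funext s z
      rcases z with z | z <;> rfl
    · rintro ⟨x, h⟩
      refine ⟨fun s z => x s z.1, x z₀.1 z₀.2, ?_⟩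
      convert h using 2
      funext s z
      rcases z with z | z
      · by_cases hz : (⟨s, z⟩ : Σ s, X s) = z₀
        · subst hz
          simp [f, MetricStructure.Tuple.snoc, MetricStructure.Tuple.append]
        · simp [f, hz, MetricStructure.Tuple.snoc, MetricStructure.Tuple.append]
      · rfl

/-! ### Saturation over countable tuples -/

/-- The entries of `y` serve as the parameter set. It is countable, hence of size below `κ`. -/
theorem MetricStructure.IsSaturated.exists_tuple {U : MetricStructure.{u, w} L}
    {κ : Cardinal.{max u w}} (hU : U.IsSaturated κ) (hκ : ℵ₀ < κ) {X : Ctx.{u, 0} L}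
    (hX : X.IsFinite) {Y : Ctx.{u, 0} L} [Countable (Σ s, Y s)] (y : U.Tuple Y) {ι : Type*}
    (φ : ι → Formula (X.sum Y))
    (h : ∀ F : Finset ι, ∀ δ > 0, ∃ x : U.Tuple X, ∀ i ∈ F, |(φ i).eval₂ U x y| ≤ δ) :
    ∃ x : U.Tuple X, ∀ i, (φ i).eval₂ U x y = 0 := by
  classical
  let A : ∀ s, Set (U.carrier s) := fun s => Set.range (y s)
  have hA : #(Σ s, A s) < κ := by
    have hs : Function.Surjective
        (fun p : Σ s, Y s => (⟨p.1, ⟨y p.1 p.2, p.2, rfl⟩⟩ : Σ s, A s)) := by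
      rintro ⟨s, _, z, rfl⟩
      exact ⟨⟨s, z⟩, rfl⟩
    have : Countable (Σ s, A s) := hs.countable
    exact (Cardinal.mk_le_aleph0).trans_lt hκ
  let f : ∀ s, X.sum Y s → X.sum (U.Params A) s :=
    fun s => Sum.map id fun z => ⟨y s z, z, rfl⟩
  have hf : ∀ i (x : U.Tuple X),
      ((φ i).rename f).eval₂ U x (U.paramTuple A) = (φ i).eval₂ U x y := by
    intro i x
    rw [Formula.eval₂, Formula.eval_rename, Formula.eval₂]
    congr 1
    funext s z
    rcases z with z | z <;> rfl
  obtain ⟨x, hx⟩ := hU A hA X hX (Set.range fun i => (φ i).rename f) (by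
    intro p₀ hp₀ hfin δ hδ
    obtain ⟨p₁, rfl⟩ := hfin.exists_finset_coe
    rw [← Set.image_univ, Finset.subset_set_image_iff] at hp₀
    obtain ⟨F, -, rfl⟩ := hp₀
    obtain ⟨x, hx⟩ := h F δ hδ
    refine ⟨x, fun ψ hψ => ?_⟩
    obtain ⟨i, hi, rfl⟩ := Finset.mem_image.mp (Finset.mem_coe.mp hψ)
    rw [hf]
    exact hx i hi)
  exact ⟨x, fun i => (hf i x).symm.trans (hx _ ⟨i, rfl⟩)⟩

/-! ### Alternation along indiscernible sequences -/

theorem MetricStructure.exists_tendsto_of_not_hasIP {U : MetricStructure.{u, w} L}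
    {κ : Cardinal.{max u w}} (hU : U.IsSaturated κ) (hκ : ℵ₀ < κ) {X Y : Ctx.{u, 0} L}
    (hX : X.IsFinite) (hY : Y.IsFinite) {φ : Formula (X.sum Y)} (hφ : ¬ φ.HasIP U)
    {a : ℕ → U.Tuple Y} (ha : U.IsIndiscernible a) (c : U.Tuple X) :
    ∃ l : ℝ, Tendsto (fun i => φ.eval₂ U c (a i)) atTop (𝓝 l) := by
  classical
  obtain ⟨C, hC⟩ := Formula.exists_bound.{u, 0, w} φ
  refine tendsto_of_no_upcrossings dense_univ ?_
    (isBoundedUnder_of ⟨C, fun i => (abs_le.mp (hC U _)).2⟩)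
    (isBoundedUnder_of ⟨-C, fun i => (abs_le.mp (hC U _)).1⟩)
  rintro r - s - hrs ⟨hr, hs⟩
  refine hφ ⟨r, s, a, hrs, fun I => ?_⟩
  -- Both sides of the gap are visited infinitely often, so `c` itself shows the pattern `I` along a
  -- subsequence `j`.
  obtain ⟨j, hj, hjI⟩ := extraction_forall_of_frequently
    (P := fun n k => (n ∈ I → φ.eval₂ U c (a k) ≤ r) ∧ (n ∉ I → s ≤ φ.eval₂ U c (a k))) (by
      intro n
      by_cases hn : n ∈ I
      · exact hr.mono fun k hk => ⟨fun _ => hk.le, fun h => (h hn).elim⟩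
      · exact hs.mono fun k hk => ⟨fun h => (hn h).elim, fun _ => hk.le⟩)
  have : Finite (Σ s, Y s) := hY
  -- The whole sequence `a` is packed into a single countable tuple of parameters.
  let Yω : Ctx.{u, 0} L := fun s => ℕ × Y s
  have : Countable (Σ s, Yω s) := by
    have hs : Function.Injective
        (fun p : Σ s, Yω s => ((p.2.1, ⟨p.1, p.2.2⟩) : ℕ × (Σ s, Y s))) := by
      rintro ⟨s, n, z⟩ ⟨s', n', z'⟩ h
      simp only [Prod.mk.injEq, Sigma.mk.injEq] at h
      obtain ⟨rfl, rfl, h⟩ := h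
      cases h
      rfl
    exact hs.countable
  -- `g i` measures the violation of the `i`-th inequality, turning it into a condition of the form
  -- `= 0`.
  let g : ℕ → C(ℝ, ℝ) := fun i =>
    if i ∈ I then ⟨fun t => max (t - r) 0, by fun_prop⟩ else ⟨fun t => max (s - t) 0, by fun_prop⟩
  have hg : ∀ i t, g i t = 0 ↔ (i ∈ I → t ≤ r) ∧ (i ∉ I → s ≤ t) := by
    intro i t
    by_cases hi : i ∈ I <;> simp [g, hi]
  let ψ : ℕ → Formula (X.sum Yω) := fun i =>
    (φ.map (g i)).rename fun s => Sum.map id fun z => (i, z)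
  let aω : U.Tuple Yω := fun s z => a z.1 s z.2
  have hψ : ∀ i x, (ψ i).eval₂ U x aω = g i (φ.eval₂ U x (a i)) := by
    intro i x
    rw [Formula.eval₂, Formula.eval_rename, Formula.eval_map, Formula.eval₂]
    congr 2
    funext s z
    rcases z with z | z <;> rfl
  obtain ⟨b, hb⟩ := hU.exists_tuple hκ hX aω ψ (by
    intro F δ hδ
    obtain ⟨n, hn⟩ := F.exists_nat_subset_range
    obtain ⟨θ, hθ⟩ := Formula.exists_sum_abs.{u, 0, w} Finset.univ fun i : Fin n =>
      ((φ.map (g i)).rename fun s => Sum.map id fun z => (i, z) :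
        Formula (X.sum (Y.copies n)))
    obtain ⟨χ, hχ⟩ := Formula.exists_inf_tuple.{u, 0, w} hX θ
    have hθ' : ∀ (x : U.Tuple X) (d : Fin n → U.Tuple Y),
        θ.eval₂ U x (.join d) = ∑ i : Fin n, |g i (φ.eval₂ U x (d i))| := by
      intro x d
      rw [Formula.eval₂, hθ]
      refine Finset.sum_congr rfl fun i _ => ?_
      rw [Formula.eval_rename, Formula.eval_map, Formula.eval₂]
      congr 3
      funext s z
      rcases z with z | z <;> rfl
    have h1 : χ.eval U (.join fun i : Fin n => a (j i)) < δ := by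
      refine (hχ U _ δ).2 ⟨c, ?_⟩
      rw [hθ', Finset.sum_eq_zero fun i _ => by rw [(hg i _).2 (hjI i), abs_zero]]
      exact hδ
    -- `χ` says that the first `n` conditions are approximately solvable; indiscernibility carries
    -- this from the subsequence `j` to the initial segment.
    rw [ha n χ (fun i => j i) (fun i => i) (fun _ _ h => hj h) (fun _ _ h => h)] at h1
    obtain ⟨x, hx⟩ := (hχ U _ δ).1 h1
    refine ⟨x, fun i hi => ?_⟩
    rw [hθ'] at hx
    rw [hψ]
    exact (Finset.single_le_sum (f := fun i : Fin n => |g i (φ.eval₂ U x (a i))|)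
      (fun _ _ => abs_nonneg _)
      (Finset.mem_univ ⟨i, Finset.mem_range.mp (hn hi)⟩)).trans hx.le)
  exact ⟨b, fun i => (hg i _).1 ((hψ i b).symm.trans (hb i))⟩

/-! ### Limits along iterated products of an ultrafilter -/

/-- The `k`-th power of a nonprincipal ultrafilter on `ℕ`. -/
noncomputable def hyperPow : (k : ℕ) → Ultrafilter (Fin k → ℕ)
  | 0 => pure Fin.elim0
  | k + 1 => (hyperPow k).bind fun i => (hyperfilter ℕ).map fun m => Fin.snoc (α := fun _ => ℕ) i m

theorem eventually_hyperPow_succ {k : ℕ} {p : (Fin (k + 1) → ℕ) → Prop} :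
    (∀ᶠ i in (hyperPow (k + 1) : Filter _), p i) ↔
      ∀ᶠ i in (hyperPow k : Filter _), ∀ᶠ m in (hyperfilter ℕ : Filter ℕ),
        p (Fin.snoc (α := fun _ => ℕ) i m) := Iff.rfl

/-- Coordinates outside the range of `j` do not affect `p`, and a quantifier "for almost all" over
an idle coordinate can be dropped. The induction peels off the last, innermost coordinate. -/
theorem eventually_hyperPow_comp {n k : ℕ} {j : Fin k → Fin n} (hj : StrictMono j)
    {p : (Fin k → ℕ) → Prop} :
    (∀ᶠ i in (hyperPow n : Filter _), p (i ∘ j)) ↔ ∀ᶠ i in (hyperPow k : Filter _), p i := by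
  induction n generalizing k with
  | zero =>
    rcases k with _ | k
    · simp only [show ∀ i : Fin 0 → ℕ, i ∘ j = i from fun i => Subsingleton.elim _ _]
    · exact (j 0).elim0
  | succ n ih =>
    rw [eventually_hyperPow_succ]
    by_cases hl : ∀ i, j i ≠ Fin.last n
    · let j' : Fin k → Fin n := fun i => (j i).castPred (hl i)
      have hj' : StrictMono j' := fun a b h => hj h
      rw [← ih hj']
      have : ∀ (i : Fin n → ℕ) (m : ℕ),
          (Fin.snoc (α := fun _ => ℕ) i m : Fin (n + 1) → ℕ) ∘ j = i ∘ j' := by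
        intro i m
        funext l
        have : j l = (j' l).castSucc := (Fin.castSucc_castPred _ _).symm
        simp only [Function.comp_apply, this, Fin.snoc_castSucc]
      simp only [this, eventually_const]
    · push Not at hl
      obtain ⟨l, hl⟩ := hl
      rcases k with _ | k
      · exact l.elim0
      -- By monotonicity only the last index can be sent to the last coordinate, so both powers peel
      -- off the same innermost quantifier.
      have hlast : l = Fin.last k := by
        by_contra h
        have := hj (Fin.lt_last_iff_ne_last.mpr h)
        rw [hl] at this
        exact absurd this (not_lt.mpr (Fin.le_last _))
      subst hlast
      have hne : ∀ i : Fin k, j i.castSucc ≠ Fin.last n := fun i h =>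
        absurd (hj (Fin.castSucc_lt_last i)) (by rw [h, hl]; exact lt_irrefl _)
      let j' : Fin k → Fin n := fun i => (j i.castSucc).castPred (hne i)
      have hj' : StrictMono j' := fun a b h => hj (Fin.castSucc_lt_castSucc_iff.mpr h)
      rw [eventually_hyperPow_succ, ← ih hj']
      have : ∀ (i : Fin n → ℕ) (m : ℕ),
          (Fin.snoc (α := fun _ => ℕ) i m : Fin (n + 1) → ℕ) ∘ j =
            Fin.snoc (α := fun _ => ℕ) (i ∘ j') m := by
        intro i m
        funext q
        refine Fin.lastCases ?_ (fun q => ?_) q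
        · simp only [Function.comp_apply, hl, Fin.snoc_last]
        · have : j q.castSucc = (j' q).castSucc := (Fin.castSucc_castPred _ _).symm
          simp only [Function.comp_apply, this, Fin.snoc_castSucc]
      simp only [this]

/-- The limit of the values of a formula at the subsequences of `c` of length `k`. -/
noncomputable def MetricStructure.limEval {M : MetricStructure.{u, w} L} {Z : Ctx.{u, 0} L}
    (c : ℕ → M.Tuple Z) {k : ℕ} (ψ : Formula (Z.copies k)) : ℝ :=
  limUnder (hyperPow k : Filter (Fin k → ℕ)) fun i => ψ.eval M (.join fun l => c (i l))

/-- The values lie in a compact interval, where every ultrafilter converges, so `limUnder` is a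
genuine limit. -/
theorem MetricStructure.tendsto_limEval {M : MetricStructure.{u, w} L} {Z : Ctx.{u, 0} L}
    (c : ℕ → M.Tuple Z) {k : ℕ} (ψ : Formula (Z.copies k)) :
    Tendsto (fun i : Fin k → ℕ => ψ.eval M (.join fun l => c (i l))) (hyperPow k)
      (𝓝 (limEval c ψ)) := by
  obtain ⟨C, hC⟩ := Formula.exists_bound.{u, 0, w} ψ
  refine tendsto_nhds_limUnder ?_
  obtain ⟨l, -, hl⟩ := (isCompact_Icc (a := -C) (b := C)).ultrafilter_le_nhds
    ((hyperPow k).map fun i : Fin k → ℕ => ψ.eval M (.join fun l => c (i l)))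
    (le_principal_iff.mpr (Ultrafilter.mem_coe.mpr (Ultrafilter.mem_map.mpr
      (Filter.univ_mem' fun i => abs_le.mp (hC M (.join fun l => c (i l)))))))
  exact ⟨l, hl⟩

/-- This coherence of marginals is the source of indiscernibility. -/
theorem MetricStructure.limEval_rename {M : MetricStructure.{u, w} L} {Z : Ctx.{u, 0} L}
    (c : ℕ → M.Tuple Z) {n k : ℕ} {j : Fin k → Fin n} (hj : StrictMono j)
    (ψ : Formula (Z.copies k)) :
    limEval c (ψ.rename fun _ z => (j z.1, z.2) : Formula (Z.copies n)) = limEval c ψ := by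
  refine tendsto_nhds_unique (tendsto_limEval c _) ?_
  simp only [Formula.eval_rename]
  intro s hs
  exact (eventually_hyperPow_comp hj
    (p := fun i => ψ.eval M (.join fun l => c (i l)) ∈ s)).2 (tendsto_limEval c ψ hs)

/-- A tuple realizing the limit type of a sequence extends by one step in a saturated model. -/
theorem MetricStructure.IsSaturated.exists_snoc {U M : MetricStructure.{u, w} L}
    {κ : Cardinal.{max u w}} (hU : U.IsSaturated κ) (hκ : ℵ₀ < κ) {Z : Ctx.{u, 0} L}
    (hZ : Z.IsFinite) (c : ℕ → M.Tuple Z) {n : ℕ} (d : Fin n → U.Tuple Z)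
    (hd : ∀ ψ : Formula (Z.copies n), ψ.eval U (.join d) = limEval c ψ) :
    ∃ x : U.Tuple Z, ∀ ψ : Formula (Z.copies (n + 1)),
      ψ.eval U (.join (Fin.snoc (α := fun _ => U.Tuple Z) d x)) = limEval c ψ := by
  classical
  have : Finite (Σ s, Z s) := hZ
  have : Countable (Σ s, Z.copies n s) := by
    have hs : Function.Injective
        (fun p : Σ s, Z.copies n s => ((p.2.1, ⟨p.1, p.2.2⟩) : Fin n × (Σ s, Z s))) := by
      rintro ⟨s, n, z⟩ ⟨s', n', z'⟩ h
      simp only [Prod.mk.injEq, Sigma.mk.injEq] at h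
      obtain ⟨rfl, rfl, h⟩ := h
      cases h
      rfl
    exact hs.countable
  let f : ∀ s, Z.copies (n + 1) s → Z.sum (Z.copies n) s := fun s z =>
    Fin.lastCases (motive := fun _ => Z.sum (Z.copies n) s) (Sum.inl z.2)
      (fun i => Sum.inr (i, z.2)) z.1
  let φ : Formula (Z.copies (n + 1)) → Formula (Z.sum (Z.copies n)) := fun ψ =>
    (ψ.map ⟨fun t => t - limEval c ψ, by fun_prop⟩).rename f
  have hφ : ∀ (N : MetricStructure.{u, w} L) (e : Fin n → N.Tuple Z) (x : N.Tuple Z) ψ,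
      (φ ψ).eval₂ N x (.join e) =
        ψ.eval N (.join (Fin.snoc (α := fun _ => N.Tuple Z) e x)) - limEval c ψ := by
    intro N e x ψ
    rw [Formula.eval₂, Formula.eval_rename, Formula.eval_map]
    change ψ.eval N _ - limEval c ψ = _
    congr 2
    funext s ⟨i, z⟩
    refine Fin.lastCases ?_ (fun i => ?_) i
    · simp [f, MetricStructure.Tuple.append, MetricStructure.Tuple.join]
    · simp [f, MetricStructure.Tuple.append, MetricStructure.Tuple.join]
  obtain ⟨x, hx⟩ := hU.exists_tuple hκ hZ (.join d) φ (by
    intro F δ hδ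
    obtain ⟨θ, hθ⟩ := Formula.exists_sum_abs.{u, 0, w} F φ
    obtain ⟨χ, hχ⟩ := Formula.exists_inf_tuple.{u, 0, w} hZ θ
    have hθ' : ∀ (N : MetricStructure.{u, w} L) (e : Fin n → N.Tuple Z) (x : N.Tuple Z),
        θ.eval₂ N x (.join e) = ∑ ψ ∈ F, |(φ ψ).eval₂ N x (.join e)| := fun N e x => hθ N _
    -- Limits preserve only weak inequalities; `δ / 2` leaves room for a strict one below `δ`.
    have h0 : limEval c χ ≤ δ / 2 := by
      refine le_of_tendsto (tendsto_limEval c χ) ?_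
      have ht : Tendsto (fun i : Fin (n + 1) → ℕ =>
          ∑ ψ ∈ F, |ψ.eval M (.join fun l => c (i l)) - limEval c ψ|) (hyperPow (n + 1))
          (𝓝 (∑ ψ ∈ F, |limEval c ψ - limEval c ψ|)) :=
        tendsto_finsetSum _ fun ψ _ => ((tendsto_limEval c ψ).sub_const _).abs
      simp only [sub_self, abs_zero, Finset.sum_const_zero] at ht
      -- For almost every `i`, almost every `m` makes `c m` an approximate solution over the tuple
      -- indexed by `i`.
      have ht' := eventually_hyperPow_succ.1 (ht.eventually_lt_const (half_pos hδ))
      refine ht'.mono fun i hi => ?_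
      obtain ⟨m, hm⟩ := hi.exists
      refine ((hχ M _ _).2 ⟨c m, ?_⟩).le
      rw [hθ']
      have he : (Fin.snoc (fun l => c (i l)) (c m) : Fin (n + 1) → M.Tuple Z) =
          fun l => c (Fin.snoc (α := fun _ => ℕ) i m l) := by
        funext l
        refine Fin.lastCases ?_ (fun l => ?_) l <;> simp
      simpa only [hφ, he] using hm
    obtain ⟨x, hx⟩ := (hχ U (.join d) δ).1 (by rw [hd]; linarith)
    refine ⟨x, fun ψ hψ => ?_⟩
    rw [hθ'] at hx
    exact (Finset.single_le_sum (f := fun ψ => |(φ ψ).eval₂ U x (.join d)|)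
      (fun _ _ => abs_nonneg _) hψ).trans hx.le)
  exact ⟨x, fun ψ => sub_eq_zero.mp ((hφ U d x ψ).symm.trans (hx ψ))⟩

/-- The limit type of a sequence is realized by an indiscernible sequence in every elementarily
equivalent saturated structure. -/
theorem MetricStructure.IsSaturated.exists_indiscernible {U M : MetricStructure.{u, w} L}
    {κ : Cardinal.{max u w}} (hU : U.IsSaturated κ) (hκ : ℵ₀ < κ)
    (hUM : ∀ φ, M.value φ = U.value φ) {Z : Ctx.{u, 0} L}
    (hZ : Z.IsFinite) (c : ℕ → M.Tuple Z) :
    ∃ d : ℕ → U.Tuple Z, U.IsIndiscernible d ∧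
      ∀ (k : ℕ) (ψ : Formula (Z.copies k)),
        ψ.eval U (.join fun l : Fin k => d l) = limEval c ψ := by
  classical
  let S : ℕ → Type _ := fun n => {d : Fin n → U.Tuple Z //
    ∀ ψ : Formula (Z.copies n), ψ.eval U (.join d) = limEval c ψ}
  -- A formula in no copies is a sentence; here elementary equivalence of `M` and `U` enters.
  have h0 : ∀ ψ : Formula (Z.copies 0),
      ψ.eval U (.join (Fin.elim0 : Fin 0 → U.Tuple Z)) = limEval c ψ := by
    intro ψ
    let σ : Sentence L := ψ.rename fun _ z => z.1.elim0
    have hσ : ∀ (N : MetricStructure.{u, w} L) (e : Fin 0 → N.Tuple Z),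
        ψ.eval N (.join e) = N.value σ := by
      intro N e
      rw [MetricStructure.value, Formula.eval_rename]
      congr 1
      funext s z
      exact z.1.elim0
    refine tendsto_nhds_unique ?_ (tendsto_limEval c ψ)
    simp only [hσ, hUM]
    exact tendsto_const_nhds
  let D : ∀ n, S n := fun n => Nat.rec ⟨Fin.elim0, h0⟩
    (fun n d => ⟨_, (hU.exists_snoc hκ hZ c d.1 d.2).choose_spec⟩) n
  let d : ℕ → U.Tuple Z := fun n => (D (n + 1)).1 (Fin.last n)
  have hD : ∀ n, (D n).1 = fun i : Fin n => d i := by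
    intro n
    induction n with
    | zero => exact Subsingleton.elim _ _
    | succ n ih =>
      funext i
      refine Fin.lastCases rfl (fun i => ?_) i
      have : (D (n + 1)).1 i.castSucc = (D n).1 i :=
        Fin.snoc_castSucc (α := fun _ => U.Tuple Z) _ _ _
      rw [this, ih]
      rfl
  have hd : ∀ (k : ℕ) (ψ : Formula (Z.copies k)),
      ψ.eval U (.join fun l : Fin k => d l) = limEval c ψ := by
    intro k ψ
    rw [← hD]
    exact (D k).2 ψ
  have hsub : ∀ (k : ℕ) (ψ : Formula (Z.copies k)) (i : Fin k → ℕ), StrictMono i →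
      ψ.eval U (.join fun l => d (i l)) = limEval c ψ := by
    intro k ψ i hi
    obtain ⟨n, hn⟩ : ∃ n, ∀ l, i l < n :=
      ⟨Finset.univ.sup i + 1, fun l => Nat.lt_succ_of_le (Finset.le_sup (Finset.mem_univ l))⟩
    have hj : StrictMono (fun l => (⟨i l, hn l⟩ : Fin n)) := fun a b h => hi h
    rw [← limEval_rename c hj ψ, ← hd, Formula.eval_rename]
    rfl
  exact ⟨d, fun k ψ i j hi hj => (hsub k ψ i hi).trans (hsub k ψ j hj).symm, hd⟩

/-! ### From the order property to an ordered indiscernible sequence -/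

theorem MetricStructure.IsIndiscernible.right {U : MetricStructure.{u, w} L} {X Y : Ctx.{u, 0} L}
    {d : ℕ → U.Tuple (X.sum Y)} (hd : U.IsIndiscernible d) :
    U.IsIndiscernible (fun i s z => d i s (Sum.inr z) : ℕ → U.Tuple Y) := by
  intro k ψ i j hi hj
  have h := hd k (ψ.rename fun _ z => (z.1, Sum.inr z.2)) i j hi hj
  rw [Formula.eval_rename, Formula.eval_rename] at h
  exact h

/-- A formula with the order property has, up to its sign, an ordered indiscernible sequence in
every elementarily equivalent saturated structure. -/
theorem Formula.HasOP.exists_indiscernible {U M : MetricStructure.{u, w} L}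
    {κ : Cardinal.{max u w}} (hU : U.IsSaturated κ) (hκ : ℵ₀ < κ)
    (hUM : ∀ φ, M.value φ = U.value φ) {X Y : Ctx.{u, 0} L} (hX : X.IsFinite) (hY : Y.IsFinite)
    {φ : Formula (X.sum Y)} (hφ : φ.HasOP M) :
    ∃ (a : ℕ → U.Tuple Y) (b : ℕ → U.Tuple X) (ε : ℝ), 0 < ε ∧ U.IsIndiscernible a ∧
      ((∀ i j, i < j → φ.eval₂ U (b j) (a i) + ε < φ.eval₂ U (b i) (a j)) ∨
        ∀ i j, i < j → -φ.eval₂ U (b j) (a i) + ε < -φ.eval₂ U (b i) (a j)) := by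
  obtain ⟨ε, p, q, hε, h⟩ := hφ
  have : Finite (Σ s, X s) := hX
  have : Finite (Σ s, Y s) := hY
  have hXY : (X.sum Y).IsFinite := Finite.of_injective
    (β := (Σ s, X s) ⊕ (Σ s, Y s))
    (fun z => Sum.elim (fun x => Sum.inl ⟨z.1, x⟩) (fun y => Sum.inr ⟨z.1, y⟩) z.2) (by
      rintro ⟨s, x | y⟩ ⟨s', x' | y'⟩ h
      all_goals simp only [Sum.elim_inl, Sum.elim_inr, Sum.inl.injEq, Sum.inr.injEq,
        Sigma.mk.injEq, reduceCtorEq] at h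
      all_goals obtain ⟨rfl, h⟩ := h; cases h; rfl)
  let r : Fin 2 → Fin 2 → ∀ s, X.sum Y s → (X.sum Y).copies 2 s := fun i j s =>
    Sum.elim (fun x => (i, Sum.inl x)) (fun y => (j, Sum.inr y))
  let δ : Formula ((X.sum Y).copies 2) :=
    .conn (n := 2) ⟨fun v => v 0 - v 1, by fun_prop⟩ ![φ.rename (r 0 1), φ.rename (r 1 0)]
  let fst : ∀ {N : MetricStructure.{u, w} L}, N.Tuple (X.sum Y) → N.Tuple X :=
    fun e s z => e s (Sum.inl z)
  let snd : ∀ {N : MetricStructure.{u, w} L}, N.Tuple (X.sum Y) → N.Tuple Y :=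
    fun e s z => e s (Sum.inr z)
  have hδ : ∀ (N : MetricStructure.{u, w} L) (e : Fin 2 → N.Tuple (X.sum Y)),
      δ.eval N (.join e) = φ.eval₂ N (fst (e 0)) (snd (e 1)) -
        φ.eval₂ N (fst (e 1)) (snd (e 0)) := by
    intro N e
    rw [Formula.eval]
    change (φ.rename (r 0 1)).eval N _ - (φ.rename (r 1 0)).eval N _ = _
    rw [Formula.eval_rename, Formula.eval_rename, Formula.eval₂, Formula.eval₂]
    congr 2 <;>
    · funext s z
      rcases z with z | z <;> rfl
  let c : ℕ → M.Tuple (X.sum Y) := fun i => (p i).append (q i)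
  obtain ⟨d, hd, hlim⟩ := hU.exists_indiscernible hκ hUM hXY c
  have hle : ε ≤ |MetricStructure.limEval c δ| := by
    refine ge_of_tendsto (MetricStructure.tendsto_limEval c δ).abs ?_
    refine eventually_hyperPow_succ.2 (eventually_hyperPow_succ.2 (.of_forall fun i₀ => .of_forall
      fun i => ?_))
    -- A nonprincipal ultrafilter contains every tail, so the iterated limit sees only increasing
    -- pairs.
    have hm : ∀ᶠ m in (hyperfilter ℕ : Filter ℕ), i < m :=
      Nat.hyperfilter_le_atTop (eventually_gt_atTop i)
    refine hm.mono fun m hm => ?_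
    rw [hδ]
    exact h i m hm
  have hall : ∀ i j, i < j → φ.eval₂ U (fst (d i)) (snd (d j)) -
      φ.eval₂ U (fst (d j)) (snd (d i)) = MetricStructure.limEval c δ := by
    intro i j hij
    rw [← hlim, hd 2 δ (fun l => l) ![i, j] (fun _ _ h => h) (by
      intro a b hab
      fin_cases a <;> fin_cases b <;> simp_all), hδ]
    rfl
  -- Halving `ε` turns the weak bound into the strict inequality of NSCP.
  refine ⟨fun i => snd (d i), fun i => fst (d i), ε / 2, half_pos hε, hd.right, ?_⟩
  rcases le_abs.mp hle with hpos | hneg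
  · exact .inl fun i j hij => by linarith [hall i j hij]
  · exact .inr fun i j hij => by linarith [hall i j hij]

end ContLogic

theorem mainTheorem5 {L : ContLogic.Language.{u}} (T : ContLogic.Theory L)
    (hT : ContLogic.Theory.IsComplete.{u, w} T) (U : ContLogic.MetricStructure.{u, w} L)
    (hU : U.IsMonster T) (hNIP : ContLogic.Theory.IsNIP.{u, w} T) (hSCP : U.IsSCP) :
    ContLogic.Theory.IsStable.{u, w} T := by
  intro M hM X Y hX hY φ hφ
  obtain ⟨hUT, κ, hκ, -, hsat, -⟩ := hU
  obtain ⟨a, b, ε, hε, ha, h | h⟩ :=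
    hφ.exists_indiscernible hsat hκ (hT.2 M U hM hUT) hX hY
  · exact hSCP X Y hX hY φ ⟨a, b, ε, hε, ha, fun c =>
      ContLogic.MetricStructure.exists_tendsto_of_not_hasIP hsat hκ hX hY
        (hNIP U hUT X Y hX hY φ) ha c, h⟩
  -- NIP and SCP quantify over all formulas, so both apply to `-φ`.
  · let neg : C(ℝ, ℝ) := ⟨fun t => -t, by fun_prop⟩
    exact hSCP X Y hX hY (φ.map neg) ⟨a, b, ε, hε, ha, fun c =>
      ContLogic.MetricStructure.exists_tendsto_of_not_hasIP hsat hκ hX hY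
        (hNIP U hUT X Y hX hY _) ha c, h⟩
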